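/- A diversity on a set $X$ is a function $\delta$ from the finite subsets of $X$ to $[0,\infty)$ with $\delta(A)=0$ whenever $|A|\le 1$ and $\delta(A\cup C)\le\delta(A\cup B)+\delta(B\cup C)$ for all finite $A,B,C\subseteq X$ with $B\ne\emptyset$. A map $\phi\colon X_1\to X_2$ between diversities $(X_1,\delta_1)$ and $(X_2,\delta_2)$ has distortion $c\ge 1$ if there are $c_1,c_2>0$ with $c=c_1c_2$ and $\frac1{c_1}\delta_1(A)\le\delta_2(\phi(A))\le c_2\,\delta_1(A)$ for all finite $A\subseteq X_1$. For a metric space $(X,d)$ let $\delta_{\mathrm{diam}}(A)=\max_{a,b\in A}d(a,b)$ be its diameter diversity. Let $\ell_1^k$ be the diversity on $\mathbb R^k$ with $\delta_1(A)=\sum_{i=1}^k\max_{a,b\in A}|a_i-b_i|$. Let $\delta_w$ be the mean-width diversity on $\mathbb R^k$, $$\delta_w(A)=\frac{\pi}{\mu_k(S^k)}\int_{S^{k-1}}\Bigl(\max_{a\in\operatorname{conv}A}a\cdot u-\min_{a\in\operatorname{conv}A}a\cdot u\Bigr)\,d\mu_{k-1}(u),$$ where $\mu_{m}$ is the surface measure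 on the unit sphere $S^{m}\subset\mathbb R^{m+1}$. (All these functions take the value $0$ at $A=\emptyset$.) **Proposition.** There is an absolute constant $C>0$ such that for every $n\ge 2$ and every metric space $(X,d)$ with $|X|=n$ (where $d(x,y)=0$ is also allowed for $x\ne y$) the following hold. 1. There are an integer $1\le k\le C\log n$ and a map $\phi\colon X\to\mathbb R^k$ that has, as a map from $(X,\delta_{\mathrm{diam}})$ to $\ell_1^k$, distortion at most $C\log^2 n$. 2. There are an integer $1\le k\le C\log n$ and a map $\phi\colon X\to\mathbb R^k$ that has, as a map from $(X,\delta_{\mathrm{diam}})$ to $(\mathbb R^k,\delta_w)$, distortion at most $C\log^{3/2} n$. -/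

import Mathlib

open scoped Classical in
/-- A diversity, with the definiteness axiom relaxed: `δ` is nonnegative, vanishes on sets with
at most one element, possibly also on other sets, and satisfies the triangle inequality. -/
structure Diversity (X : Type*) where
  /-- the value of the diversity on a finite set -/
  δ : Finset X → ℝ
  nonneg : ∀ A, 0 ≤ δ A
  eq_zero : ∀ A, A.card ≤ 1 → δ A = 0
  triangle : ∀ A B C, B.Nonempty → δ (A ∪ C) ≤ δ (A ∪ B) + δ (B ∪ C)

namespace Diversity

open scoped Classical in
/-- The map `φ` between two diversities has distortion `c ≥ 1`. -/
def HasDistortion {X Y : Type*} (D₁ : Diversity X) (D₂ : Diversity Y) (φ : X → Y) (c : ℝ) : Prop :=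
  1 ≤ c ∧ ∃ c₁ c₂ : ℝ, 0 < c₁ ∧ 0 < c₂ ∧ c = c₁ * c₂ ∧
    ∀ A : Finset X, 1 / c₁ * D₁.δ A ≤ D₂.δ (A.image φ) ∧ D₂.δ (A.image φ) ≤ c₂ * D₁.δ A

open scoped Classical in
theorem diam_image_triangle {X Y : Type*} [PseudoMetricSpace Y] (f : X → Y)
    (A B C : Finset X) (hB : B.Nonempty) :
    Metric.diam (f '' (↑(A ∪ C) : Set X)) ≤
      Metric.diam (f '' (↑(A ∪ B) : Set X)) + Metric.diam (f '' (↑(B ∪ C) : Set X)) := by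
  obtain ⟨b, hb⟩ := hB
  refine le_trans (Metric.diam_mono (t := f '' (↑(A ∪ B) : Set X) ∪ f '' (↑(B ∪ C) : Set X)) ?_
    (((A ∪ B).finite_toSet.image f).union ((B ∪ C).finite_toSet.image f)).isBounded) ?_
  · rw [← Set.image_union]
    refine Set.image_mono ?_
    intro x hx
    simp only [Finset.coe_union, Set.mem_union, Finset.mem_coe] at hx ⊢
    tauto
  · exact Metric.diam_union' ⟨f b, Set.mem_image_of_mem _ (by simp [hb]),
      Set.mem_image_of_mem _ (by simp [hb])⟩

theorem diam_image_eq_zero {X Y : Type*} [PseudoMetricSpace Y] (f : X → Y)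
    (A : Finset X) (hA : A.card ≤ 1) : Metric.diam (f '' (A : Set X)) = 0 := by
  refine Metric.diam_subsingleton (Set.Subsingleton.image ?_ f)
  intro x hx y hy
  exact Finset.card_le_one.1 hA x hx y hy

/-- The diameter diversity of a metric space: `δ(A)` is the diameter of `A`. -/
noncomputable def diameter (X : Type*) [PseudoMetricSpace X] : Diversity X where
  δ A := Metric.diam (A : Set X)
  nonneg _ := Metric.diam_nonneg
  eq_zero A hA := by simpa using diam_image_eq_zero id A hA
  triangle A B C hB := by
    simpa only [Set.image_id] using diam_image_triangle id A B C hB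

/-- The diversity `ℓ₁ᵏ` on `ℝᵏ`: `δ₁(A) = ∑ᵢ max {|aᵢ - bᵢ| : a, b ∈ A}`. -/
noncomputable def ell1 (k : ℕ) : Diversity (Fin k → ℝ) where
  δ A := ∑ i, Metric.diam ((fun a : Fin k → ℝ => a i) '' (A : Set (Fin k → ℝ)))
  nonneg _ := Finset.sum_nonneg fun _ _ => Metric.diam_nonneg
  eq_zero A hA := Finset.sum_eq_zero fun _ _ => diam_image_eq_zero _ A hA
  triangle A B C hB := by
    rw [← Finset.sum_add_distrib]
    refine Finset.sum_le_sum fun i _ => ?_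
    exact diam_image_triangle (fun a : Fin k → ℝ => a i) A B C hB

end Diversity

/-- The width of `K` in direction `u`: `max_{a ∈ K} a · u - min_{a ∈ K} a · u`. -/
noncomputable def directionalWidth {k : ℕ} (K : Set (EuclideanSpace ℝ (Fin k)))
    (u : EuclideanSpace ℝ (Fin k)) : ℝ :=
  sSup ((fun a => inner ℝ a u) '' K) - sInf ((fun a => inner ℝ a u) '' K)

/-- The surface measure on the unit sphere of `ℝᵏ`. -/
noncomputable def surfaceMeasure (k : ℕ) :
    MeasureTheory.Measure (Metric.sphere (0 : EuclideanSpace ℝ (Fin k)) 1) :=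
  (MeasureTheory.volume : MeasureTheory.Measure (EuclideanSpace ℝ (Fin k))).toSphere

/-- The absolute mean width of `K ⊆ ℝᵏ`: the integral of the width over the unit sphere `S^(k-1)`
of `ℝᵏ`, divided by the surface measure of the unit sphere `S^k` of `ℝ^(k+1)`. -/
noncomputable def absoluteMeanWidth {k : ℕ} (K : Set (EuclideanSpace ℝ (Fin k))) : ℝ :=
  1 / (surfaceMeasure (k + 1)).real Set.univ *
    ∫ u, directionalWidth K (u : EuclideanSpace ℝ (Fin k)) ∂(surfaceMeasure k)

theorem directionalWidth_convexHull {k : ℕ} (A : Finset (EuclideanSpace ℝ (Fin k)))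
    (u : EuclideanSpace ℝ (Fin k)) :
    directionalWidth (convexHull ℝ (A : Set (EuclideanSpace ℝ (Fin k)))) u =
      Metric.diam ((fun a => inner ℝ a u) '' (A : Set (EuclideanSpace ℝ (Fin k)))) := by
  have h : (fun a : EuclideanSpace ℝ (Fin k) => inner ℝ a u) ''
      (convexHull ℝ (A : Set (EuclideanSpace ℝ (Fin k)))) =
      convexHull ℝ ((fun a => inner ℝ a u) '' (A : Set (EuclideanSpace ℝ (Fin k)))) := by
    have hu : (fun a : EuclideanSpace ℝ (Fin k) => inner ℝ a u) =
        innerₗ (EuclideanSpace ℝ (Fin k)) u := by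
      ext a
      simp only [innerₗ_apply_apply, real_inner_comm]
    rw [hu]
    exact (innerₗ (EuclideanSpace ℝ (Fin k)) u).image_convexHull
      (A : Set (EuclideanSpace ℝ (Fin k)))
  have hb : Bornology.IsBounded
      ((fun a => inner ℝ a u) '' (A : Set (EuclideanSpace ℝ (Fin k)))) :=
    (A.finite_toSet.image _).isBounded
  rw [directionalWidth, h, ← Real.diam_eq (isBounded_convexHull.2 hb), convexHull_diam]

theorem integrable_directionalWidth {k : ℕ} (A : Finset (EuclideanSpace ℝ (Fin k))) :
    MeasureTheory.Integrable
      (fun u : Metric.sphere (0 : EuclideanSpace ℝ (Fin k)) 1 =>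
        directionalWidth (convexHull ℝ (A : Set (EuclideanSpace ℝ (Fin k))))
          (u : EuclideanSpace ℝ (Fin k))) (surfaceMeasure k) := by
  have : MeasureTheory.IsFiniteMeasure (surfaceMeasure k) := by
    unfold surfaceMeasure; infer_instance
  refine Continuous.integrable_of_hasCompactSupport ?_ (HasCompactSupport.of_compactSpace _)
  simp only [directionalWidth_convexHull]
  rcases A.eq_empty_or_nonempty with rfl | hA
  · simpa using continuous_const
  · have : ∀ u : Metric.sphere (0 : EuclideanSpace ℝ (Fin k)) 1,
        Metric.diam ((fun a => inner ℝ a (u : EuclideanSpace ℝ (Fin k))) ''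
          (A : Set (EuclideanSpace ℝ (Fin k)))) =
        A.sup' hA (fun a => inner ℝ a (u : EuclideanSpace ℝ (Fin k))) -
        A.inf' hA (fun a => inner ℝ a (u : EuclideanSpace ℝ (Fin k))) := by
      intro u
      rw [Real.diam_eq (A.finite_toSet.image _).isBounded, Finset.sup'_eq_csSup_image,
        Finset.inf'_eq_csInf_image]
    simp only [this]
    refine Continuous.sub ?_ ?_
    · exact Continuous.finset_sup'_apply hA fun a _ => by fun_prop
    · exact Continuous.finset_inf'_apply hA fun a _ => by fun_prop

/-- The mean-width diversity on `ℝᵏ`: `π` times the absolute mean width of the convex hull. -/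
noncomputable def Diversity.meanWidth (k : ℕ) : Diversity (EuclideanSpace ℝ (Fin k)) where
  δ A := Real.pi * absoluteMeanWidth (convexHull ℝ (A : Set (EuclideanSpace ℝ (Fin k))))
  nonneg A := by
    refine mul_nonneg Real.pi_pos.le (mul_nonneg (by positivity) ?_)
    refine MeasureTheory.integral_nonneg fun u => ?_
    simp only [directionalWidth_convexHull]
    exact Metric.diam_nonneg
  eq_zero A hA := by
    simp [absoluteMeanWidth, directionalWidth_convexHull, Diversity.diam_image_eq_zero _ A hA]
  triangle A B C hB := by
    rw [← mul_add]
    refine mul_le_mul_of_nonneg_left ?_ Real.pi_pos.le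
    unfold absoluteMeanWidth
    rw [← mul_add, ← MeasureTheory.integral_add (integrable_directionalWidth _)
      (integrable_directionalWidth _)]
    refine mul_le_mul_of_nonneg_left ?_ (by positivity)
    refine MeasureTheory.integral_mono (integrable_directionalWidth _)
      ((integrable_directionalWidth _).add (integrable_directionalWidth _)) fun u => ?_
    simp only [directionalWidth_convexHull]
    exact Diversity.diam_image_triangle
      (fun a => inner ℝ a (u : EuclideanSpace ℝ (Fin k))) A B C hB

/-! Everything reduces to one Euclidean embedding. If `φ : X → ℝᵏ` with `k = O(log n)` distorts
distances by `O(log n)`, it distorts diameters of finite sets by the same factor. On `ℝᵏ` the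
diameter is at most the `ℓ₁` diversity and at least `1/k` times it. The mean width lies between
`1/4` and `3√k` times the diameter, because its normalising constant has order `√k` while the mean
of `|⟨v, u⟩|` over the unit sphere is at least `‖v‖ / (2√k)`. Multiplying the losses gives `log n ·
k` and `log n · √k`.

The embedding (`exists_euclidean_embedding`) composes two random constructions.
`exists_bourgain_embedding` uses distances to random subsets of density `2⁻ʲ`, one coordinate for
each pair (density, subset). `exists_sign_matrix` then reduces the dimension to `O(log n)` at the
cost of a constant factor. The sign averages behind it also give Khintchine's inequality, which
yields the lower bound on the sphere. -/

/-! ### Moments of random signed sums. -/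

open scoped BigOperators in
/-- The average of `F (∑ i, ± t i)` over all choices of the signs. -/
noncomputable def signAvg {N : ℕ} (t : Fin N → ℝ) (F : ℝ → ℝ) : ℝ :=
  𝔼 ε : Fin N → Bool, F (∑ i, (if ε i then 1 else -1) * t i)

open scoped BigOperators in
theorem signAvg_zero (t : Fin 0 → ℝ) (F : ℝ → ℝ) : signAvg t F = F 0 := by
  simp [signAvg]

-- Conditioning on the first sign; this drives the inductions on the number of signs.
open scoped BigOperators in
theorem signAvg_succ {N : ℕ} (t : Fin (N + 1) → ℝ) (F : ℝ → ℝ) :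
    signAvg t F = signAvg (fun i => t i.succ) fun s => (F (s + t 0) + F (s - t 0)) / 2 := by
  unfold signAvg
  rw [Fintype.expect_eq_sum_div_card, Fintype.expect_eq_sum_div_card,
    ← (Fin.consEquiv fun _ => Bool).sum_comp, Fintype.sum_prod_type, Fintype.sum_bool,
    ← Finset.sum_add_distrib, ← Finset.sum_div, div_div]
  congr 1
  · refine Finset.sum_congr rfl fun ε _ => ?_
    simp [Fin.consEquiv, Fin.sum_univ_succ]
    ring_nf
  · simp [pow_succ]; ring

theorem signAvg_mono {N : ℕ} (t : Fin N → ℝ) {F G : ℝ → ℝ} (h : ∀ s, F s ≤ G s) :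
    signAvg t F ≤ signAvg t G :=
  Finset.expect_le_expect fun _ _ => h _

theorem signAvg_add {N : ℕ} (t : Fin N → ℝ) (F G : ℝ → ℝ) :
    signAvg t (fun s => F s + G s) = signAvg t F + signAvg t G :=
  Finset.expect_add_distrib _ _ _

theorem signAvg_const_mul {N : ℕ} (t : Fin N → ℝ) (c : ℝ) (F : ℝ → ℝ) :
    signAvg t (fun s => c * F s) = c * signAvg t F :=
  (Finset.mul_expect _ _ _).symm

theorem signAvg_const {N : ℕ} (t : Fin N → ℝ) (c : ℝ) : signAvg t (fun _ => c) = c := by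
  simp [signAvg]

theorem signAvg_sq {N : ℕ} (t : Fin N → ℝ) : signAvg t (fun s => s ^ 2) = ∑ i, t i ^ 2 := by
  induction N with
  | zero => simp [signAvg_zero]
  | succ N ih =>
    have h : (fun s : ℝ => ((s + t 0) ^ 2 + (s - t 0) ^ 2) / 2) = fun s => s ^ 2 + t 0 ^ 2 := by
      ext s; ring
    rw [signAvg_succ, h, signAvg_add, signAvg_const, ih, Fin.sum_univ_succ, add_comm]

theorem signAvg_pow_four_le {N : ℕ} (t : Fin N → ℝ) :
    signAvg t (fun s => s ^ 4) ≤ 3 * (∑ i, t i ^ 2) ^ 2 := by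
  induction N with
  | zero => simp [signAvg_zero]
  | succ N ih =>
    have h : (fun s : ℝ => ((s + t 0) ^ 4 + (s - t 0) ^ 4) / 2) =
        fun s => s ^ 4 + (6 * t 0 ^ 2 * s ^ 2 + t 0 ^ 4) := by
      ext s; ring
    rw [signAvg_succ, h, signAvg_add, signAvg_add, signAvg_const, signAvg_const_mul, signAvg_sq,
      Fin.sum_univ_succ]
    nlinarith [ih fun i => t i.succ, sq_nonneg (t 0 ^ 2)]

/-- Averaging over one sign produces a `cosh`, and `cosh x ≤ exp (x² / 2)` turns it back into a
Gaussian with `a` replaced by `a + 2a²t₀²`. The hypothesis `h` survives this change, since `(1 +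
x)(1 - x) ≤ 1` for `x = 2at₀²`. -/
theorem signAvg_exp_sq_le {N : ℕ} (t : Fin N → ℝ) {a : ℝ} (ha : 0 ≤ a)
    (h : a * (2 * ∑ i, t i ^ 2 + 2) ≤ 1) :
    signAvg t (fun s => Real.exp (a * s ^ 2)) ≤ Real.exp ((∑ i, t i ^ 2) / 2) := by
  induction N generalizing a with
  | zero => simp [signAvg_zero]
  | succ N ih =>
    rw [Fin.sum_univ_succ] at h ⊢
    have hT : 0 ≤ ∑ i : Fin N, t i.succ ^ 2 := Finset.sum_nonneg fun _ _ => sq_nonneg _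
    have h0 : 0 ≤ t 0 ^ 2 := sq_nonneg _
    set T := ∑ i : Fin N, t i.succ ^ 2
    have key : ∀ s : ℝ, (Real.exp (a * (s + t 0) ^ 2) + Real.exp (a * (s - t 0) ^ 2)) / 2 ≤
        Real.exp (t 0 ^ 2 / 2) * Real.exp ((a + 2 * a ^ 2 * t 0 ^ 2) * s ^ 2) := by
      intro s
      have h1 : (Real.exp (a * (s + t 0) ^ 2) + Real.exp (a * (s - t 0) ^ 2)) / 2 =
          Real.exp (a * s ^ 2 + a * t 0 ^ 2) * Real.cosh (2 * a * s * t 0) := by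
        rw [Real.cosh_eq, mul_div_assoc', mul_add, ← Real.exp_add, ← Real.exp_add]
        ring_nf
      rw [h1]
      refine (mul_le_mul_of_nonneg_left (Real.cosh_le_exp_half_sq _) (Real.exp_pos _).le).trans ?_
      rw [← Real.exp_add, ← Real.exp_add]
      refine Real.exp_le_exp.2 ?_
      nlinarith
    rw [signAvg_succ]
    refine (signAvg_mono _ key).trans ?_
    rw [signAvg_const_mul, add_div, Real.exp_add]
    refine mul_le_mul_of_nonneg_left (ih _ (by positivity) ?_) (Real.exp_pos _).le
    have hx : 0 ≤ 2 * a * t 0 ^ 2 := by positivity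
    have e : (a + 2 * a ^ 2 * t 0 ^ 2) * (2 * T + 2) =
      (1 + 2 * a * t 0 ^ 2) * (a * (2 * T + 2)) := by ring
    rw [e]
    have h2 : a * (2 * T + 2) ≤ 1 - 2 * a * t 0 ^ 2 := by linarith
    nlinarith [mul_le_mul_of_nonneg_left h2 (by linarith : 0 ≤ 1 + 2 * a * t 0 ^ 2)]

/-- Second and fourth moments suffice: `exp (-y) ≤ 1 - y + y²/2` at `y = s²/3` averages to at most
`1 - 1/3 + 3/18`. -/
theorem signAvg_exp_neg_sq_le {N : ℕ} (t : Fin N → ℝ) (h : ∑ i, t i ^ 2 = 1) :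
    signAvg t (fun s => Real.exp (-(s ^ 2 / 3))) ≤ 5 / 6 := by
  have key : ∀ s : ℝ, Real.exp (-(s ^ 2 / 3)) ≤ 1 + ((-(1 / 3)) * s ^ 2 + 1 / 18 * s ^ 4) := by
    intro s
    have := Real.quadratic_le_exp_of_nonneg (x := s ^ 2 / 3) (by positivity)
    rw [Real.exp_neg, inv_le_iff_one_le_mul₀ (Real.exp_pos _)]
    have h2 : 0 < 1 + ((-(1 / 3)) * s ^ 2 + 1 / 18 * s ^ 4) := by nlinarith [sq_nonneg (s ^ 2 - 3)]
    refine le_trans ?_ (mul_le_mul_of_nonneg_left this h2.le)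
    nlinarith [sq_nonneg (s ^ 4)]
  refine (signAvg_mono _ key).trans ?_
  rw [signAvg_add, signAvg_const, signAvg_add, signAvg_const_mul, signAvg_const_mul, signAvg_sq, h]
  have := signAvg_pow_four_le t
  rw [h] at this
  linarith

/-- Khintchine's inequality. -/
theorem half_le_signAvg_abs {N : ℕ} (t : Fin N → ℝ) (h : ∑ i, t i ^ 2 = 1) :
    1 / 2 ≤ signAvg t (fun s => |s|) := by
  -- A polynomial minorant of `|s|` whose average is at least `1 - 3/6`.
  have key : ∀ s : ℝ, s ^ 2 + (-(1 / 6)) * s ^ 4 ≤ |s| := by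
    intro s
    rw [← sq_abs, show s ^ 4 = |s| ^ 4 from (Even.pow_abs (by decide) s).symm]
    have : 0 ≤ |s| := abs_nonneg s
    generalize |s| = x at *
    have : 0 ≤ 1 - x + x ^ 3 / 6 := by
      nlinarith [mul_nonneg (by linarith : 0 ≤ x + 3) (sq_nonneg (x - 3 / 2))]
    nlinarith
  refine le_trans ?_ (signAvg_mono _ key)
  rw [signAvg_add, signAvg_const_mul, signAvg_sq, h]
  have := signAvg_pow_four_le t
  rw [h] at this
  linarith

/-! ### Dimension reduction by a random sign matrix. -/

-- The rows of the sign matrix are independent.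
open scoped BigOperators in
theorem expect_prod_eq_signAvg_pow {N : ℕ} (k : ℕ) (t : Fin N → ℝ) (F : ℝ → ℝ) :
    𝔼 ε : Fin k → Fin N → Bool, ∏ i, F (∑ j, (if ε i j then 1 else -1) * t j) =
      signAvg t F ^ k := by
  rw [signAvg, Finset.expect_pow, Fintype.piFinset_univ]

open scoped BigOperators in
/-- A Johnson-Lindenstrauss lemma with constant distortion, for matrices of signs. -/
theorem exists_sign_matrix {ι : Type*} [Fintype ι] {N k : ℕ} (v : ι → Fin N → ℝ)
    (hk : 2 * Fintype.card ι * Real.exp (-(k / 11 : ℝ)) < 1) :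
    ∃ ε : Fin k → Fin N → Bool, ∀ x,
      (k : ℝ) / 4 * ∑ j, v x j ^ 2 ≤ ∑ i, (∑ j, (if ε i j then 1 else -1) * v x j) ^ 2 ∧
      ∑ i, (∑ j, (if ε i j then 1 else -1) * v x j) ^ 2 ≤ 4 * k * ∑ j, v x j ^ 2 := by
  set r : ι → ℝ := fun x => √(∑ j, v x j ^ 2)
  have hr : ∀ x, r x ^ 2 = ∑ j, v x j ^ 2 :=
    fun x => Real.sq_sqrt (Finset.sum_nonneg fun _ _ => sq_nonneg _)
  set u : ι → Fin N → ℝ := fun x j => v x j / r x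
  have hu : ∀ x, r x ≠ 0 → ∑ j, u x j ^ 2 = 1 := by
    intro x hx
    simp only [u, div_pow, ← Finset.sum_div, ← hr]
    exact div_self (pow_ne_zero 2 hx)
  have hv : ∀ x j, v x j = r x * u x j := by
    intro x j
    by_cases hx : r x = 0
    · have h0 : ∑ j, v x j ^ 2 = 0 := by rw [← hr, hx]; simp
      rw [Finset.sum_eq_zero_iff_of_nonneg fun _ _ => sq_nonneg _] at h0
      simpa [hx] using h0 j (Finset.mem_univ j)
    · exact (mul_div_cancel₀ _ hx).symm
  set S : (Fin k → Fin N → Bool) → ι → Fin k → ℝ :=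
    fun ε x i => ∑ j, (if ε i j then 1 else -1) * u x j
  have hS : ∀ ε x, ∑ i, (∑ j, (if ε i j then 1 else -1) * v x j) ^ 2 =
      r x ^ 2 * ∑ i, S ε x i ^ 2 := by
    intro ε x
    rw [Finset.mul_sum]
    refine Finset.sum_congr rfl fun i _ => ?_
    rw [← mul_pow, Finset.mul_sum]
    congr 1
    refine Finset.sum_congr rfl fun j _ => ?_
    rw [hv]; ring
  -- Exponential Markov bounds for both tails at once: `bad ε x < 1` makes both exponents negative,
  -- that is, `k/4 < ∑ i, S ε x i ^ 2 < 4k`. If the average of `∑ x, bad ε x` is below `1`, some `ε`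
  -- works for all `x`.
  set bad : (Fin k → Fin N → Bool) → ι → ℝ := fun ε x => if r x = 0 then 0 else
    Real.exp (-(k : ℝ)) * ∏ i, Real.exp (1 / 4 * S ε x i ^ 2) +
      Real.exp (k / 12 : ℝ) * ∏ i, Real.exp (-(S ε x i ^ 2 / 3))
  have hbad0 : ∀ ε x, 0 ≤ bad ε x := by
    intro ε x
    simp only [bad]
    split_ifs <;> positivity
  have hbad : ∀ x, 𝔼 ε, bad ε x ≤ 2 * Real.exp (-(k / 11 : ℝ)) := by
    intro x
    by_cases hx : r x = 0
    · simp only [bad, hx, if_true, Finset.expect_const_zero]; positivity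
    · simp only [bad, hx, if_false, S]
      rw [Finset.expect_add_distrib, ← Finset.mul_expect, ← Finset.mul_expect,
        expect_prod_eq_signAvg_pow k (u x) fun s => Real.exp (1 / 4 * s ^ 2),
        expect_prod_eq_signAvg_pow k (u x) fun s => Real.exp (-(s ^ 2 / 3)), two_mul]
      have h1 := signAvg_exp_sq_le (u x) (a := 1 / 4) (by norm_num) (by rw [hu x hx]; norm_num)
      have h2 := signAvg_exp_neg_sq_le (u x) (hu x hx)
      have hn1 : 0 ≤ signAvg (u x) fun s => Real.exp (1 / 4 * s ^ 2) :=
        Finset.expect_nonneg fun _ _ => (Real.exp_pos _).le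
      have hn2 : 0 ≤ signAvg (u x) fun s => Real.exp (-(s ^ 2 / 3)) :=
        Finset.expect_nonneg fun _ _ => (Real.exp_pos _).le
      rw [hu x hx] at h1
      -- The rate `7/40` lies just below `log (6/5)`, and `1/12 - 7/40 = -11/120` is below `-1/11`.
      have h3 : (5 / 6 : ℝ) ≤ Real.exp (-(7 / 40)) := by
        have h4 : (1 - 7 / 400 : ℝ) ^ 10 ≤ Real.exp (-(7 / 400)) ^ 10 :=
          pow_le_pow_left₀ (by norm_num) (Real.one_sub_le_exp_neg _) 10
        rw [← Real.exp_nat_mul] at h4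
        refine le_trans (by norm_num) (h4.trans_eq ?_)
        norm_num
      refine add_le_add ?_ ?_
      · refine (mul_le_mul_of_nonneg_left (pow_le_pow_left₀ hn1 h1 k) (Real.exp_pos _).le).trans ?_
        rw [← Real.exp_nat_mul, ← Real.exp_add]
        refine Real.exp_le_exp.2 ?_
        have : (0 : ℝ) ≤ k := Nat.cast_nonneg k
        linarith
      · refine (mul_le_mul_of_nonneg_left (pow_le_pow_left₀ hn2 (h2.trans h3) k)
          (Real.exp_pos _).le).trans ?_
        rw [← Real.exp_nat_mul, ← Real.exp_add]
        refine Real.exp_le_exp.2 ?_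
        have : (0 : ℝ) ≤ k := Nat.cast_nonneg k
        linarith
  obtain ⟨ε, hε⟩ : ∃ ε, ∑ x, bad ε x < 1 := by
    by_contra! hcon
    have h1 : (1 : ℝ) ≤ 𝔼 ε, ∑ x, bad ε x := by
      rw [← Fintype.expect_const (ι := Fin k → Fin N → Bool) (1 : ℝ)]
      exact Finset.expect_le_expect fun ε _ => hcon ε
    rw [Finset.expect_sum_comm] at h1
    have h2 := h1.trans (Finset.sum_le_sum fun x _ => hbad x)
    rw [Finset.sum_const, nsmul_eq_mul, Finset.card_univ] at h2
    linarith
  refine ⟨ε, fun x => ?_⟩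
  rw [hS, ← hr]
  by_cases hx : r x = 0
  · simp [hx]
  have hb : bad ε x < 1 :=
    (Finset.single_le_sum (fun y _ => hbad0 ε y) (Finset.mem_univ x)).trans_lt hε
  simp only [bad, hx, if_false] at hb
  rw [← Real.exp_sum, ← Real.exp_sum, ← Real.exp_add, ← Real.exp_add, Finset.sum_neg_distrib,
    ← Finset.mul_sum, ← Finset.sum_div] at hb
  have hb1 := Real.exp_lt_one_iff.1 (lt_of_le_of_lt (le_add_of_nonneg_right (Real.exp_pos _).le) hb)
  have hb2 := Real.exp_lt_one_iff.1 (lt_of_le_of_lt (le_add_of_nonneg_left (Real.exp_pos _).le) hb)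
  have hp : 0 ≤ r x ^ 2 := sq_nonneg _
  constructor <;> nlinarith

/-! ### Random subsets and Bourgain's embedding. -/

/-- The probability that a random subset of `X`, containing each point independently with
probability `p`, equals `A`. -/
noncomputable def subsetWeight {X : Type*} [Fintype X] (p : ℝ) (A : Finset X) : ℝ :=
  p ^ A.card * (1 - p) ^ (Fintype.card X - A.card)

theorem subsetWeight_nonneg {X : Type*} [Fintype X] {p : ℝ} (h0 : 0 ≤ p) (h1 : p ≤ 1)
    (A : Finset X) : 0 ≤ subsetWeight p A :=
  mul_nonneg (pow_nonneg h0 _) (pow_nonneg (by linarith) _)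

theorem sum_subsetWeight {X : Type*} [Fintype X] (p : ℝ) :
    ∑ A : Finset X, subsetWeight p A = 1 := by
  simp [subsetWeight, Fintype.sum_pow_mul_eq_add_pow]

theorem sum_subsetWeight_disjoint {X : Type*} [Fintype X] [DecidableEq X] (p : ℝ) (V : Finset X) :
    ∑ A : Finset X, (if Disjoint A V then subsetWeight p A else 0) = (1 - p) ^ V.card := by
  -- Expanding this product over subsets, the factor `0` on `V` kills exactly the subsets meeting
  -- `V`.
  have h := Fintype.prod_add (fun x : X => if x ∈ V then 0 else p) (fun _ => 1 - p)
  have h1 : ∀ x : X, (if x ∈ V then 0 else p) + (1 - p) = if x ∈ V then 1 - p else 1 := by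
    intro x; split_ifs <;> ring
  simp only [h1, Finset.prod_ite_mem, Finset.univ_inter, Finset.prod_const] at h
  rw [h]
  refine Finset.sum_congr rfl fun A _ => ?_
  split_ifs with hA
  · rw [subsetWeight, Finset.card_compl, Finset.prod_congr rfl (g := fun _ => p),
      Finset.prod_const]
    intro x hx
    rw [if_neg (Finset.disjoint_left.1 hA hx)]
  · obtain ⟨x, hx, hxV⟩ := Finset.not_disjoint_iff.1 hA
    rw [Finset.prod_eq_zero hx (by simp [hxV]), zero_mul]

theorem sum_subsetWeight_hit_miss {X : Type*} [Fintype X] [DecidableEq X] (p : ℝ)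
    {U V : Finset X} (hUV : Disjoint U V) :
    ∑ A : Finset X, (if ¬ Disjoint A U ∧ Disjoint A V then subsetWeight p A else 0) =
      (1 - p) ^ V.card * (1 - (1 - p) ^ U.card) := by
  have h : ∀ A : Finset X, (if ¬ Disjoint A U ∧ Disjoint A V then subsetWeight p A else 0) =
      (if Disjoint A V then subsetWeight p A else 0) -
        (if Disjoint A (U ∪ V) then subsetWeight p A else 0) := by
    intro A
    simp only [Finset.disjoint_union_right]
    by_cases h1 : Disjoint A U <;> by_cases h2 : Disjoint A V <;> simp [h1, h2]
  simp only [h, Finset.sum_sub_distrib, sum_subsetWeight_disjoint,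
    Finset.card_union_of_disjoint hUV]
  ring

/-- With density `2⁻ʲ`, where `2ʲ` is about `#U`, the random set meets `U` and misses `V` with
probability bounded below. -/
theorem one_twelfth_le_hit_miss {X : Type*} [Fintype X] [DecidableEq X]
    {U V : Finset X} (hUV : Disjoint U V) (hU : U.Nonempty) (hc : V.card ≤ U.card) :
    1 / 12 ≤ ∑ A : Finset X, (if ¬ Disjoint A U ∧ Disjoint A V then
      subsetWeight ((1 / 2) ^ (Nat.log 2 U.card + 1)) A else 0) := by
  rw [sum_subsetWeight_hit_miss _ hUV]
  have hU0 : U.card ≠ 0 := hU.card_pos.ne'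
  set l := Nat.log 2 U.card
  have hl1 : 2 ^ l ≤ U.card := Nat.pow_log_le_self 2 hU0
  have hl2 : U.card ≤ 2 ^ (l + 1) := (Nat.lt_pow_succ_log_self (by norm_num) _).le
  set p : ℝ := (1 / 2) ^ (l + 1)
  have hp0 : 0 < p := by positivity
  have hp : p * 2 ^ l = 1 / 2 := by
    simp only [p, pow_succ, one_div, inv_pow]; field_simp
  have hp1 : p ≤ 1 := pow_le_one₀ (by norm_num) (by norm_num)
  have hq0 : 0 ≤ 1 - p := by linarith
  -- As `p * 2 ^ l = 1/2`, Bernoulli's inequality and `exp (-1/2) ≤ 2/3` pin this power between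
  -- `1/2` and `2/3`. Hence `V` is missed with probability at least `1/4` and `U` with probability
  -- at most `2/3`, and `1/4 * (1 - 2/3) = 1/12`.
  have h1 : 1 / 2 ≤ (1 - p) ^ 2 ^ l := by
    have := one_add_mul_le_pow (a := -p) (by linarith) (2 ^ l)
    push_cast at this
    rw [← sub_eq_add_neg] at this
    nlinarith
  have h2 : (1 - p) ^ 2 ^ l ≤ 2 / 3 := by
    have h3 : (1 - p) ^ 2 ^ l ≤ Real.exp (-p) ^ 2 ^ l :=
      pow_le_pow_left₀ hq0 (Real.one_sub_le_exp_neg p) _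
    rw [← Real.exp_nat_mul] at h3
    push_cast at h3
    rw [show (2 : ℝ) ^ l * -p = -(1 / 2) by linarith, Real.exp_neg] at h3
    refine h3.trans ?_
    rw [inv_le_comm₀ (Real.exp_pos _) (by norm_num)]
    have := Real.add_one_le_exp (1 / 2 : ℝ)
    linarith
  have h3 : 1 / 4 ≤ (1 - p) ^ V.card := by
    calc (1 / 4 : ℝ) ≤ ((1 - p) ^ 2 ^ l) ^ 2 := by nlinarith
      _ = (1 - p) ^ 2 ^ (l + 1) := by rw [← pow_mul, pow_succ 2 l]
      _ ≤ (1 - p) ^ V.card := pow_le_pow_of_le_one hq0 (by linarith) (hc.trans hl2)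
  have h4 : (1 - p) ^ U.card ≤ 2 / 3 := (pow_le_pow_of_le_one hq0 (by linarith) hl1).trans h2
  nlinarith

/-- The closed balls of radius `r` about `x` and `y` are disjoint. A set that hits the larger one
and misses the other has `r` between its distances to `x` and `y`; the density adapted to the larger
ball is one of those summed. -/
theorem one_twelfth_le_separate {X : Type*} [Fintype X] [PseudoMetricSpace X] (x y : X) {r : ℝ}
    (hr0 : 0 ≤ r) (hr : 2 * r < dist x y) :
    1 / 12 ≤ ∑ j : Fin (Nat.log 2 (Fintype.card X) + 1), ∑ A : Finset X,
      subsetWeight ((1 / 2) ^ (j.1 + 1)) A *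
        (Set.Ico (min (Metric.infDist x A) (Metric.infDist y A))
          (max (Metric.infDist x A) (Metric.infDist y A))).indicator 1 r := by
  classical
  wlog hxy : (Finset.univ.filter fun z => dist y z ≤ r).card ≤
      (Finset.univ.filter fun z => dist x z ≤ r).card generalizing x y
  · have := this y x (by rwa [dist_comm]) (le_of_not_ge hxy)
    simpa only [min_comm, max_comm] using this
  set U := Finset.univ.filter fun z => dist x z ≤ r
  set V := Finset.univ.filter fun z => dist y z ≤ r
  have hUV : Disjoint U V := by
    refine Finset.disjoint_left.2 fun z hz hz' => ?_
    simp only [U, V, Finset.mem_filter, Finset.mem_univ, true_and] at hz hz'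
    have := dist_triangle_right x y z
    linarith
  have hU : U.Nonempty := ⟨x, by simp [U, hr0]⟩
  have hw : ∀ (j : ℕ) (A : Finset X), 0 ≤ subsetWeight ((1 / 2) ^ (j + 1)) A := fun j A =>
    subsetWeight_nonneg (by positivity) (pow_le_one₀ (by norm_num) (by norm_num)) A
  refine (one_twelfth_le_hit_miss hUV hU hxy).trans ?_
  refine le_trans ?_ (Finset.single_le_sum (f := fun j : Fin (Nat.log 2 (Fintype.card X) + 1) =>
    ∑ A : Finset X, subsetWeight ((1 / 2) ^ (j.1 + 1)) A *
        (Set.Ico (min (Metric.infDist x A) (Metric.infDist y A))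
          (max (Metric.infDist x A) (Metric.infDist y A))).indicator 1 r) ?_
    (Finset.mem_univ ⟨Nat.log 2 U.card,
      Nat.lt_succ_of_le (Nat.log_mono_right (Finset.card_le_univ U))⟩))
  · refine Finset.sum_le_sum fun A _ => ?_
    split_ifs with h
    · obtain ⟨h1, h2⟩ := h
      obtain ⟨z, hzA, hzU⟩ := Finset.not_disjoint_iff.1 h1
      have hx : Metric.infDist x A ≤ r :=
        (Metric.infDist_le_dist_of_mem hzA).trans (Finset.mem_filter.1 hzU).2
      have hy : r < Metric.infDist y A := by
        obtain ⟨w, hw, hw'⟩ := A.finite_toSet.isCompact.exists_infDist_eq_dist ⟨z, hzA⟩ y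
        rw [hw']
        by_contra! hcon
        exact Finset.disjoint_left.1 h2 hw (by simp [V, hcon])
      have hmem : r ∈ Set.Ico (min (Metric.infDist x A) (Metric.infDist y A))
          (max (Metric.infDist x A) (Metric.infDist y A)) :=
        ⟨min_le_of_left_le hx, lt_max_of_lt_right hy⟩
      simp [Set.indicator_of_mem hmem]
    · exact mul_nonneg (hw _ _) (Set.indicator_nonneg (fun _ _ => by simp) _)
  · exact fun j _ => Finset.sum_nonneg fun A _ =>
      mul_nonneg (hw _ _) (Set.indicator_nonneg (fun _ _ => by simp) _)

/-- Integrate the separation bound over `0 ≤ r < dist x y / 2`: each indicator integrates to at most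
the gap between the two distances to `A`. -/
theorem dist_div_le_sum_abs_infDist_sub {X : Type*} [Fintype X] [PseudoMetricSpace X] (x y : X) :
    dist x y / 24 ≤ ∑ j : Fin (Nat.log 2 (Fintype.card X) + 1), ∑ A : Finset X,
      subsetWeight ((1 / 2) ^ (j.1 + 1)) A * |Metric.infDist x A - Metric.infDist y A| := by
  have hw : ∀ (j : ℕ) (A : Finset X), 0 ≤ subsetWeight ((1 / 2) ^ (j + 1)) A := fun j A =>
    subsetWeight_nonneg (by positivity) (pow_le_one₀ (by norm_num) (by norm_num)) A
  set I : Set ℝ := Set.Ico 0 (dist x y / 2)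
  have hint : ∀ a b : ℝ, MeasureTheory.IntegrableOn ((Set.Ico a b).indicator (1 : ℝ → ℝ)) I := by
    intro a b
    refine MeasureTheory.Integrable.indicator ?_ measurableSet_Ico
    exact MeasureTheory.integrableOn_const (by simp [I])
  have h1 : dist x y / 24 = ∫ _ in I, (1 / 12 : ℝ) := by
    simp [I]; rw [max_eq_left (by positivity)]; ring
  rw [h1]
  refine (MeasureTheory.setIntegral_mono_on
    (g := fun r => ∑ j : Fin (Nat.log 2 (Fintype.card X) + 1), ∑ A : Finset X,
      subsetWeight ((1 / 2) ^ (j.1 + 1)) A *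
        (Set.Ico (min (Metric.infDist x A) (Metric.infDist y A))
          (max (Metric.infDist x A) (Metric.infDist y A))).indicator 1 r)
    (MeasureTheory.integrableOn_const (by simp)) ?_ measurableSet_Ico
    fun r hr => one_twelfth_le_separate x y hr.1 (by have := hr.2; linarith)).trans ?_
  · exact MeasureTheory.integrable_finsetSum _ fun j _ =>
      MeasureTheory.integrable_finsetSum _ fun A _ => (hint _ _).const_mul _
  rw [MeasureTheory.integral_finsetSum _ fun j _ =>
      MeasureTheory.integrable_finsetSum _ fun A _ => (hint _ _).const_mul _]
  refine Finset.sum_le_sum fun j _ => ?_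
  rw [MeasureTheory.integral_finsetSum _ fun A _ => (hint _ _).const_mul _]
  refine Finset.sum_le_sum fun A _ => ?_
  rw [MeasureTheory.integral_const_mul]
  refine mul_le_mul_of_nonneg_left ?_ (hw _ _)
  rw [MeasureTheory.integral_indicator_one measurableSet_Ico,
    MeasureTheory.measureReal_restrict_apply measurableSet_Ico]
  refine (MeasureTheory.measureReal_mono Set.inter_subset_left (by simp)).trans_eq ?_
  simp [max_sub_min_eq_abs]
  rw [abs_sub_comm]

/-- Bourgain's embedding, with unboundedly many coordinates. -/
theorem exists_bourgain_embedding (X : Type*) [Fintype X] [PseudoMetricSpace X] :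
    ∃ (N : ℕ) (f : X → Fin N → ℝ), ∀ x y,
      dist x y ^ 2 / (576 * (Nat.log 2 (Fintype.card X) + 1)) ≤ ∑ j, (f x j - f y j) ^ 2 ∧
      ∑ j, (f x j - f y j) ^ 2 ≤ (Nat.log 2 (Fintype.card X) + 1) * dist x y ^ 2 := by
  set m := Nat.log 2 (Fintype.card X) + 1
  have hw : ∀ (j : ℕ) (A : Finset X), 0 ≤ subsetWeight ((1 / 2) ^ (j + 1)) A := fun j A =>
    subsetWeight_nonneg (by positivity) (pow_le_one₀ (by norm_num) (by norm_num)) A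
  have htot : ∑ q : Fin m × Finset X, subsetWeight ((1 / 2) ^ (q.1.1 + 1)) q.2 = m := by
    rw [Fintype.sum_prod_type]
    simp [sum_subsetWeight]
  let e := Fintype.equivFin (Fin m × Finset X)
  -- Square roots of the weights make the squared Euclidean distance a weighted sum of squared gaps.
  refine ⟨_, fun x i => √(subsetWeight ((1 / 2) ^ ((e.symm i).1.1 + 1)) (e.symm i).2) *
    Metric.infDist x (e.symm i).2, fun x y => ?_⟩
  rw [e.symm.sum_comp fun q : Fin m × Finset X =>
    (√(subsetWeight ((1 / 2) ^ (q.1.1 + 1)) q.2) * Metric.infDist x q.2 -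
      √(subsetWeight ((1 / 2) ^ (q.1.1 + 1)) q.2) * Metric.infDist y q.2) ^ 2]
  simp only [← mul_sub, mul_pow, Real.sq_sqrt (hw _ _)]
  have hm : ((Nat.log 2 (Fintype.card X) : ℝ) + 1) = m := by simp [m]
  rw [hm]
  have hm0 : (0 : ℝ) < m := by rw [← hm]; positivity
  constructor
  · have h1 := dist_div_le_sum_abs_infDist_sub x y
    rw [← Fintype.sum_prod_type' (f := fun (j : Fin m) (A : Finset X) =>
      subsetWeight ((1 / 2) ^ (j.1 + 1)) A * |Metric.infDist x A - Metric.infDist y A|)] at h1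
    -- Cauchy–Schwarz passes from the weighted `ℓ₁` bound to `ℓ₂` at the cost of the total weight
    -- `m`; `576 = 24²`.
    have h2 := Finset.sum_mul_sq_le_sq_mul_sq Finset.univ
      (fun q : Fin m × Finset X => √(subsetWeight ((1 / 2) ^ (q.1.1 + 1)) q.2))
      (fun q => √(subsetWeight ((1 / 2) ^ (q.1.1 + 1)) q.2) *
        |Metric.infDist x q.2 - Metric.infDist y q.2|)
    simp only [← mul_assoc, Real.mul_self_sqrt (hw _ _), Real.sq_sqrt (hw _ _), mul_pow, sq_abs,
      htot] at h2
    rw [div_le_iff₀ (by positivity)]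
    have h3 := pow_le_pow_left₀ (by positivity) h1 2
    linarith
  · rw [← htot, Finset.sum_mul]
    refine Finset.sum_le_sum fun q _ => mul_le_mul_of_nonneg_left ?_ (hw _ _)
    rw [← sq_abs]
    refine pow_le_pow_left₀ (abs_nonneg _) ?_ 2
    -- This covers `A = ∅` too, where `infDist` is constantly `0`.
    have := (Metric.lipschitz_infDist_pt (q.2 : Set X)).dist_le_mul x y
    simpa [Real.dist_eq] using this

/-! ### Euclidean embedding in logarithmic dimension. -/

theorem natLog_two_add_one_le {n : ℕ} (hn : 2 ≤ n) : (Nat.log 2 n + 1 : ℝ) ≤ 3 * Real.log n := by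
  have h2 := Real.log_two_gt_d9
  have h1 : (Nat.log 2 n : ℝ) * Real.log 2 ≤ Real.log n := by
    rw [← Real.log_pow]
    refine Real.log_le_log (by positivity) ?_
    exact_mod_cast Nat.pow_log_le_self 2 (by omega)
  have h3 : Real.log 2 ≤ Real.log n := Real.log_le_log (by norm_num) (by exact_mod_cast hn)
  have h4 : (0 : ℝ) ≤ Nat.log 2 n := Nat.cast_nonneg _
  nlinarith

/-- Bourgain's embedding theorem for finite pseudometric spaces, in logarithmic dimension. -/
theorem exists_euclidean_embedding (X : Type*) [PseudoMetricSpace X] [Fintype X] {n : ℕ}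
    (hX : Fintype.card X = n) (hn : 2 ≤ n) :
    ∃ (k : ℕ) (φ : X → EuclideanSpace ℝ (Fin k)), 1 ≤ k ∧ (k : ℝ) ≤ 46 * Real.log n ∧
      ∀ x y, dist x y ≤ dist (φ x) (φ y) ∧
        dist (φ x) (φ y) ≤ 288 * Real.log n * dist x y := by
  obtain ⟨N, f, hf⟩ := exists_bourgain_embedding X
  rw [hX] at hf
  have hm := natLog_two_add_one_le hn
  have hm0 : (0 : ℝ) < Nat.log 2 n + 1 := by positivity
  set m : ℝ := Nat.log 2 n + 1
  have hlog2 := Real.log_two_gt_d9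
  have hlog : Real.log 2 ≤ Real.log n := Real.log_le_log (by norm_num) (by exact_mod_cast hn)
  -- With `44 = 4 * 11` the failure term is at most `2n² * n⁻⁴ < 1`, over the `n²` difference
  -- vectors.
  set k := ⌈44 * Real.log n⌉₊
  have hk1 : 44 * Real.log n ≤ k := Nat.le_ceil _
  have hk2 : (k : ℝ) < 44 * Real.log n + 1 := Nat.ceil_lt_add_one (by linarith)
  have hk0 : (0 : ℝ) < k := by linarith
  have hk : 2 * (Fintype.card (X × X) : ℝ) * Real.exp (-(k / 11 : ℝ)) < 1 := by
    have hn0 : (0 : ℝ) < n := by positivity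
    have hn2 : (2 : ℝ) ≤ n := by exact_mod_cast hn
    have h1 : Real.exp (-(k / 11 : ℝ)) ≤ ((n : ℝ) ^ 4)⁻¹ := by
      rw [← Real.exp_log (inv_pos.2 (pow_pos hn0 4)), Real.log_inv, Real.log_pow]
      refine Real.exp_le_exp.2 ?_
      push_cast
      linarith
    rw [Fintype.card_prod, hX]
    push_cast
    refine (mul_le_mul_of_nonneg_left h1 (by positivity)).trans_lt ?_
    rw [← div_eq_mul_inv, div_lt_one (by positivity)]
    have : 4 ≤ (n : ℝ) ^ 2 := by nlinarith
    nlinarith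
  obtain ⟨ε, hε⟩ := exists_sign_matrix (fun (q : X × X) j => f q.1 j - f q.2 j) hk
  -- The scaling makes the lower bound exact: `s² * (k/4) / (576m) = 1`. The upper bound becomes `s²
  -- * 4k * m = (96m)²`.
  set s : ℝ := √(2304 * m / k)
  have hs : s ^ 2 = 2304 * m / k := Real.sq_sqrt (by positivity)
  set φ : X → EuclideanSpace ℝ (Fin k) := fun x =>
    WithLp.toLp 2 fun i => s * ∑ j, (if ε i j then 1 else -1) * f x j
  have hφ : ∀ x y, dist (φ x) (φ y) ^ 2 =
      s ^ 2 * ∑ i, (∑ j, (if ε i j then 1 else -1) * (f x j - f y j)) ^ 2 := by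
    intro x y
    rw [EuclideanSpace.dist_sq_eq, Finset.mul_sum]
    refine Finset.sum_congr rfl fun i _ => ?_
    simp only [φ, Real.dist_eq, sq_abs, ← mul_sub, ← Finset.sum_sub_distrib, mul_pow]
  refine ⟨k, φ, by exact_mod_cast hk0, by linarith, fun x y => ⟨?_, ?_⟩⟩
  · refine le_of_sq_le_sq ?_ dist_nonneg
    rw [hφ]
    refine le_trans ?_ (mul_le_mul_of_nonneg_left (hε (x, y)).1 (sq_nonneg s))
    refine le_trans (le_of_eq ?_) (mul_le_mul_of_nonneg_left
      (mul_le_mul_of_nonneg_left (hf x y).1 (by positivity)) (sq_nonneg s))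
    rw [hs]
    field_simp
    ring
  · have h1 : dist (φ x) (φ y) ≤ 96 * m * dist x y := by
      refine le_of_sq_le_sq ?_ (by positivity)
      rw [hφ]
      refine (mul_le_mul_of_nonneg_left (hε (x, y)).2 (sq_nonneg s)).trans ?_
      refine (mul_le_mul_of_nonneg_left
        (mul_le_mul_of_nonneg_left (hf x y).2 (by positivity)) (sq_nonneg s)).trans_eq ?_
      rw [hs]
      field_simp
      ring
    refine h1.trans (mul_le_mul_of_nonneg_right ?_ dist_nonneg)
    linarith

/-! ### Diameters under maps and coordinate projections. -/

theorem diam_le_diam_image {X Y : Type*} [PseudoMetricSpace X] [PseudoMetricSpace Y] {f : X → Y}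
    (h : ∀ x y, dist x y ≤ dist (f x) (f y)) (A : Finset X) :
    Metric.diam (A : Set X) ≤ Metric.diam (f '' A) :=
  Metric.diam_le_of_forall_dist_le Metric.diam_nonneg fun x hx y hy => (h x y).trans <|
    Metric.dist_le_diam_of_mem (A.finite_toSet.image f).isBounded (Set.mem_image_of_mem f hx)
      (Set.mem_image_of_mem f hy)

theorem diam_image_le_mul_diam {X Y : Type*} [PseudoMetricSpace X] [PseudoMetricSpace Y]
    {f : X → Y} {c : ℝ} (hc : 0 ≤ c) (h : ∀ x y, dist (f x) (f y) ≤ c * dist x y) (A : Finset X) :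
    Metric.diam (f '' A) ≤ c * Metric.diam (A : Set X) := by
  refine Metric.diam_le_of_forall_dist_le (mul_nonneg hc Metric.diam_nonneg) ?_
  rintro _ ⟨x, hx, rfl⟩ _ ⟨y, hy, rfl⟩
  exact (h x y).trans (mul_le_mul_of_nonneg_left
    (Metric.dist_le_diam_of_mem A.finite_toSet.isBounded hx hy) hc)

theorem diam_le_sum_diam_coord {k : ℕ} (B : Finset (EuclideanSpace ℝ (Fin k))) :
    Metric.diam (B : Set (EuclideanSpace ℝ (Fin k))) ≤
      ∑ i, Metric.diam ((fun b : EuclideanSpace ℝ (Fin k) => b i) '' B) := by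
  refine Metric.diam_le_of_forall_dist_le (Finset.sum_nonneg fun _ _ => Metric.diam_nonneg) ?_
  intro x hx y hy
  have h1 : dist x y ≤ ∑ i, dist (x i) (y i) := by
    refine le_of_sq_le_sq ?_ (Finset.sum_nonneg fun _ _ => dist_nonneg)
    rw [EuclideanSpace.dist_sq_eq]
    exact Finset.sum_sq_le_sq_sum_of_nonneg fun _ _ => dist_nonneg
  refine h1.trans (Finset.sum_le_sum fun i _ => ?_)
  exact Metric.dist_le_diam_of_mem (B.finite_toSet.image _).isBounded
    (Set.mem_image_of_mem _ hx) (Set.mem_image_of_mem _ hy)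

theorem sum_diam_coord_le {k : ℕ} (B : Finset (EuclideanSpace ℝ (Fin k))) :
    ∑ i, Metric.diam ((fun b : EuclideanSpace ℝ (Fin k) => b i) '' B) ≤
      k * Metric.diam (B : Set (EuclideanSpace ℝ (Fin k))) := by
  refine (Finset.sum_le_card_nsmul _ _ (Metric.diam (B : Set (EuclideanSpace ℝ (Fin k))))
    fun i _ => ?_).trans_eq (by simp)
  rw [← one_mul (Metric.diam (B : Set (EuclideanSpace ℝ (Fin k))))]
  refine diam_image_le_mul_diam zero_le_one (fun x y => ?_) B
  rw [one_mul, dist_eq_norm, dist_eq_norm]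
  exact PiLp.norm_apply_le (x - y) i

/-! ### Rotation invariance and first moments on the sphere. -/

/-- The action of a linear isometry on the unit sphere. -/
noncomputable def sphereMap {k : ℕ} (L : EuclideanSpace ℝ (Fin k) ≃ₗᵢ[ℝ] EuclideanSpace ℝ (Fin k))
    (u : Metric.sphere (0 : EuclideanSpace ℝ (Fin k)) 1) :
    Metric.sphere (0 : EuclideanSpace ℝ (Fin k)) 1 :=
  ⟨L u, by simp⟩

theorem continuous_sphereMap {k : ℕ}
    (L : EuclideanSpace ℝ (Fin k) ≃ₗᵢ[ℝ] EuclideanSpace ℝ (Fin k)) : Continuous (sphereMap L) :=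
  (L.continuous.comp continuous_subtype_val).subtype_mk _

-- Surface measure is a multiple of the volume of the cone over a set, and linear isometries
-- preserve cones and volume.
open scoped Pointwise in
theorem measurePreserving_sphereMap {k : ℕ}
    (L : EuclideanSpace ℝ (Fin k) ≃ₗᵢ[ℝ] EuclideanSpace ℝ (Fin k)) :
    MeasureTheory.MeasurePreserving (sphereMap L) (surfaceMeasure k) (surfaceMeasure k) := by
  refine ⟨(continuous_sphereMap L).measurable, MeasureTheory.Measure.ext fun s hs => ?_⟩
  have hm := (continuous_sphereMap L).measurable
  rw [MeasureTheory.Measure.map_apply hm hs, surfaceMeasure,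
    MeasureTheory.Measure.toSphere_apply' _ hs, MeasureTheory.Measure.toSphere_apply' _ (hm hs)]
  congr 1
  have h : (Set.Ioo (0 : ℝ) 1 • (Subtype.val '' (sphereMap L ⁻¹' s)) :
      Set (EuclideanSpace ℝ (Fin k))) =
      L.toMeasurableEquiv ⁻¹' (Set.Ioo (0 : ℝ) 1 • (Subtype.val '' s)) := by
    ext x
    simp only [Set.mem_smul, Set.mem_preimage, Set.mem_image]
    constructor
    · rintro ⟨r, hr, _, ⟨u, hu, rfl⟩, rfl⟩
      exact ⟨r, hr, _, ⟨_, hu, rfl⟩, (L.map_smul r _).symm⟩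
    · rintro ⟨r, hr, _, ⟨u, hu, rfl⟩, hx⟩
      refine ⟨r, hr, _, ⟨sphereMap L.symm u, ?_, rfl⟩, ?_⟩
      · convert hu
        exact Subtype.ext (L.apply_symm_apply u)
      · apply L.injective
        rw [L.map_smul]
        exact (congrArg (r • ·) (L.apply_symm_apply u)).trans hx
  rw [h]
  exact L.measurePreserving.measure_preimage_equiv (f := L.toMeasurableEquiv) _

theorem integral_abs_inner_sphere_congr {k : ℕ} {v w : EuclideanSpace ℝ (Fin k)}
    (h : ‖v‖ = ‖w‖) :
    ∫ u, |inner ℝ v (u : EuclideanSpace ℝ (Fin k))| ∂surfaceMeasure k =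
      ∫ u, |inner ℝ w (u : EuclideanSpace ℝ (Fin k))| ∂surfaceMeasure k := by
  -- Vectors of equal norm are swapped by the reflection in their perpendicular bisector.
  set L := (ℝ ∙ (w - v))ᗮ.reflection
  have hL : L w = v := Submodule.reflection_sub h.symm
  rw [← (measurePreserving_sphereMap L).map_eq, MeasureTheory.integral_map
    (continuous_sphereMap L).aemeasurable, (measurePreserving_sphereMap L).map_eq]
  · refine MeasureTheory.integral_congr_ae (Filter.Eventually.of_forall fun u => ?_)
    simp only [sphereMap]
    rw [← hL, L.inner_map_map]
  · exact (Continuous.aestronglyMeasurable (by fun_prop))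

instance isFiniteMeasure_surfaceMeasure (k : ℕ) :
    MeasureTheory.IsFiniteMeasure (surfaceMeasure k) := by
  unfold surfaceMeasure; infer_instance

theorem integrable_surfaceMeasure {k : ℕ}
    {f : Metric.sphere (0 : EuclideanSpace ℝ (Fin k)) 1 → ℝ} (hf : Continuous f) :
    MeasureTheory.Integrable f (surfaceMeasure k) :=
  hf.integrable_of_hasCompactSupport (HasCompactSupport.of_compactSpace _)

/-- A lower bound for the first absolute moment of a coordinate of a random point of the sphere. -/
theorem le_integral_abs_inner_sphere {k : ℕ} (hk : 1 ≤ k) (v : EuclideanSpace ℝ (Fin k)) :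
    ‖v‖ / (2 * √k) * (surfaceMeasure k).real Set.univ ≤
      ∫ u, |inner ℝ v (u : EuclideanSpace ℝ (Fin k))| ∂surfaceMeasure k := by
  have hk0 : (0 : ℝ) < k := by exact_mod_cast hk
  -- By rotation invariance `v` may be replaced by any sign vector of the same norm. Averaging over
  -- the signs, Khintchine's inequality with coefficients `u i` bounds the integrand at every `u`.
  set e : (Fin k → Bool) → EuclideanSpace ℝ (Fin k) := fun ε =>
    WithLp.toLp 2 fun i => ‖v‖ / √k * (if ε i then 1 else -1)
  have he : ∀ ε, ‖v‖ = ‖e ε‖ := by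
    intro ε
    refine (sq_eq_sq₀ (norm_nonneg _) (norm_nonneg _)).1 ?_
    rw [EuclideanSpace.norm_sq_eq (e ε)]
    have : ∀ i, ‖e ε i‖ ^ 2 = ‖v‖ ^ 2 / k := by
      intro i
      simp only [e, Real.norm_eq_abs, sq_abs, mul_pow, div_pow, Real.sq_sqrt hk0.le]
      split_ifs <;> simp
    simp only [this, Finset.sum_const, Finset.card_univ, Fintype.card_fin, nsmul_eq_mul]
    field_simp
  have hinner : ∀ ε (u : EuclideanSpace ℝ (Fin k)), |inner ℝ (e ε) u| =
      ‖v‖ / √k * |∑ i, (if ε i then 1 else -1) * u i| := by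
    intro ε u
    rw [← abs_of_nonneg (by positivity : 0 ≤ ‖v‖ / √k), ← abs_mul, Finset.mul_sum, PiLp.inner_apply]
    congr 1
    refine Finset.sum_congr rfl fun i _ => ?_
    simp only [e, RCLike.inner_apply, conj_trivial]
    ring
  have hcard : (0 : ℝ) < Fintype.card (Fin k → Bool) := by exact_mod_cast Fintype.card_pos
  have hsum : (Fintype.card (Fin k → Bool) : ℝ) *
      ∫ u, |inner ℝ v (u : EuclideanSpace ℝ (Fin k))| ∂surfaceMeasure k =
      ∫ u, ∑ ε, |inner ℝ (e ε) (u : EuclideanSpace ℝ (Fin k))| ∂surfaceMeasure k := by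
    rw [MeasureTheory.integral_finsetSum _ fun ε _ => integrable_surfaceMeasure (by fun_prop)]
    simp only [← integral_abs_inner_sphere_congr (he _)]
    simp
  have hpt : ∀ u : Metric.sphere (0 : EuclideanSpace ℝ (Fin k)) 1,
      (Fintype.card (Fin k → Bool) : ℝ) * (‖v‖ / (2 * √k)) ≤
        ∑ ε, |inner ℝ (e ε) (u : EuclideanSpace ℝ (Fin k))| := by
    intro u
    have hu : ∑ i, (u : EuclideanSpace ℝ (Fin k)) i ^ 2 = 1 := by
      have := EuclideanSpace.norm_sq_eq (u : EuclideanSpace ℝ (Fin k))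
      simpa using this.symm
    have h := half_le_signAvg_abs _ hu
    rw [signAvg, Fintype.expect_eq_sum_div_card, le_div_iff₀ hcard] at h
    simp only [hinner, ← Finset.mul_sum]
    refine le_trans (le_of_eq ?_) (mul_le_mul_of_nonneg_left h (by positivity))
    field_simp
  have hint := MeasureTheory.integral_mono (μ := surfaceMeasure k)
    (MeasureTheory.integrable_const _) (integrable_surfaceMeasure (by fun_prop)) hpt
  rw [← hsum, MeasureTheory.integral_const, smul_eq_mul] at hint
  refine le_of_mul_le_mul_left ?_ hcard
  linarith

/-! ### The normalising constant of the mean width has order `√k`. -/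

/-- Log-convexity of `Γ` at the midpoint of `x` and `x + 1`. -/
theorem Gamma_add_half_le {x : ℝ} (hx : 0 < x) :
    Real.Gamma (x + 1 / 2) ≤ √x * Real.Gamma x := by
  have h := Real.Gamma_mul_add_mul_le_rpow_Gamma_mul_rpow_Gamma hx (by linarith : 0 < x + 1)
    (by norm_num : (0 : ℝ) < 1 / 2) (by norm_num : (0 : ℝ) < 1 / 2) (by norm_num)
  have hG := Real.Gamma_pos_of_pos hx
  rw [Real.Gamma_add_one hx.ne', ← Real.sqrt_eq_rpow, ← Real.sqrt_eq_rpow,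
    Real.sqrt_mul hx.le, show (1 / 2 * x + 1 / 2 * (x + 1) : ℝ) = x + 1 / 2 by ring] at h
  refine h.trans_eq ?_
  rw [mul_left_comm, Real.mul_self_sqrt hG.le]

theorem le_Gamma_add_half {x : ℝ} (hx : 1 / 2 < x) :
    √(x - 1 / 2) * Real.Gamma x ≤ Real.Gamma (x + 1 / 2) := by
  have h0 : 0 < x - 1 / 2 := by linarith
  have h := Gamma_add_half_le h0
  rw [sub_add_cancel] at h
  refine (mul_le_mul_of_nonneg_left h (Real.sqrt_nonneg _)).trans_eq ?_
  rw [← mul_assoc, Real.mul_self_sqrt h0.le, ← Real.Gamma_add_one h0.ne']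
  congr 1
  ring

theorem surfaceMeasure_real_univ {k : ℕ} (hk : 1 ≤ k) :
    (surfaceMeasure k).real Set.univ = k * (√Real.pi ^ k / Real.Gamma (k / 2 + 1)) := by
  have : Nonempty (Fin k) := ⟨⟨0, hk⟩⟩
  rw [surfaceMeasure, MeasureTheory.Measure.toSphere_real_apply_univ, MeasureTheory.measureReal_def,
    EuclideanSpace.volume_ball]
  have : 0 ≤ √Real.pi ^ k / Real.Gamma (k / 2 + 1) :=
    div_nonneg (by positivity) (Real.Gamma_pos_of_pos (by positivity)).le
  simp [ENNReal.toReal_ofReal this]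

theorem pi_mul_surfaceMeasure_ratio {k : ℕ} (hk : 1 ≤ k) :
    Real.pi * (1 / (surfaceMeasure (k + 1)).real Set.univ * (surfaceMeasure k).real Set.univ) =
      √Real.pi * (k / (k + 1)) *
        (Real.Gamma (k / 2 + 1 + 1 / 2) / Real.Gamma (k / 2 + 1)) := by
  rw [surfaceMeasure_real_univ hk, surfaceMeasure_real_univ (by omega)]
  push_cast
  rw [show ((k + 1) / 2 + 1 : ℝ) = k / 2 + 1 + 1 / 2 by ring]
  have h1 : 0 < Real.Gamma (k / 2 + 1 + 1 / 2 : ℝ) := Real.Gamma_pos_of_pos (by positivity)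
  have h2 : 0 < Real.Gamma (k / 2 + 1 : ℝ) := Real.Gamma_pos_of_pos (by positivity)
  have h3 : 0 < √Real.pi := Real.sqrt_pos.2 Real.pi_pos
  have h4 : Real.pi = √Real.pi * √Real.pi := (Real.mul_self_sqrt Real.pi_pos.le).symm
  generalize √Real.pi = s at *
  rw [h4]
  field_simp
  ring

theorem pi_mul_surfaceMeasure_ratio_le {k : ℕ} (hk : 1 ≤ k) :
    Real.pi * (1 / (surfaceMeasure (k + 1)).real Set.univ * (surfaceMeasure k).real Set.univ) ≤
      3 * √k := by
  have hk1 : (1 : ℝ) ≤ k := by exact_mod_cast hk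
  have hG : 0 < Real.Gamma (k / 2 + 1 : ℝ) := Real.Gamma_pos_of_pos (by positivity)
  rw [pi_mul_surfaceMeasure_ratio hk]
  have h1 : Real.Gamma (k / 2 + 1 + 1 / 2) / Real.Gamma (k / 2 + 1) ≤ √(k / 2 + 1 : ℝ) :=
    (div_le_iff₀ hG).2 (Gamma_add_half_le (by positivity))
  have h2 : (k / (k + 1) : ℝ) ≤ 1 := (div_le_one (by positivity)).2 (by linarith)
  calc _ ≤ √Real.pi * 1 * √(k / 2 + 1 : ℝ) := by gcongr
    _ = √(Real.pi * (k / 2 + 1)) := by rw [mul_one, Real.sqrt_mul Real.pi_pos.le]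
    _ ≤ √(3 ^ 2 * k) := by
        refine Real.sqrt_le_sqrt ?_
        have := Real.pi_lt_d2
        nlinarith
    _ = 3 * √k := by rw [Real.sqrt_mul (by norm_num), Real.sqrt_sq (by norm_num)]

theorem le_pi_mul_surfaceMeasure_ratio {k : ℕ} (hk : 1 ≤ k) :
    √k / 2 ≤
      Real.pi * (1 / (surfaceMeasure (k + 1)).real Set.univ * (surfaceMeasure k).real Set.univ) := by
  have hk1 : (1 : ℝ) ≤ k := by exact_mod_cast hk
  have hG : 0 < Real.Gamma (k / 2 + 1 : ℝ) := Real.Gamma_pos_of_pos (by positivity)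
  rw [pi_mul_surfaceMeasure_ratio hk]
  have h1 : √(k / 2 + 1 - 1 / 2 : ℝ) ≤
      Real.Gamma (k / 2 + 1 + 1 / 2) / Real.Gamma (k / 2 + 1) :=
    (le_div_iff₀ hG).2 (le_Gamma_add_half (by linarith))
  have h2 : (1 / 2 : ℝ) ≤ k / (k + 1) := by
    rw [div_le_div_iff₀ (by norm_num) (by positivity)]; linarith
  calc √k / 2 = √k * (1 / 2) := by ring
    _ ≤ √(Real.pi * (k / 2 + 1 - 1 / 2)) * (1 / 2) := by
        refine mul_le_mul_of_nonneg_right (Real.sqrt_le_sqrt ?_) (by norm_num)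
        have := Real.pi_gt_d2
        nlinarith
    _ = √Real.pi * (1 / 2) * √(k / 2 + 1 - 1 / 2 : ℝ) := by
        rw [Real.sqrt_mul Real.pi_pos.le]; ring
    _ ≤ _ := by gcongr

/-! ### Mean width against diameter. -/

theorem meanWidth_le {k : ℕ} (hk : 1 ≤ k) (B : Finset (EuclideanSpace ℝ (Fin k))) :
    (Diversity.meanWidth k).δ B ≤
      3 * √k * Metric.diam (B : Set (EuclideanSpace ℝ (Fin k))) := by
  have h : ∫ u, directionalWidth (convexHull ℝ (B : Set (EuclideanSpace ℝ (Fin k))))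
      (u : EuclideanSpace ℝ (Fin k)) ∂surfaceMeasure k ≤
      (surfaceMeasure k).real Set.univ * Metric.diam (B : Set (EuclideanSpace ℝ (Fin k))) := by
    rw [← smul_eq_mul, ← MeasureTheory.integral_const]
    refine MeasureTheory.integral_mono (integrable_directionalWidth B)
      (MeasureTheory.integrable_const _) fun u => ?_
    simp only [directionalWidth_convexHull]
    refine Metric.diam_le_of_forall_dist_le Metric.diam_nonneg ?_
    rintro _ ⟨x, hx, rfl⟩ _ ⟨y, hy, rfl⟩
    refine le_trans ?_ (Metric.dist_le_diam_of_mem B.finite_toSet.isBounded hx hy)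
    rw [Real.dist_eq, ← inner_sub_left, dist_eq_norm]
    simpa using abs_real_inner_le_norm (x - y) (u : EuclideanSpace ℝ (Fin k))
  calc (Diversity.meanWidth k).δ B ≤ Real.pi * (1 / (surfaceMeasure (k + 1)).real Set.univ *
        ((surfaceMeasure k).real Set.univ *
          Metric.diam (B : Set (EuclideanSpace ℝ (Fin k))))) :=
      mul_le_mul_of_nonneg_left (mul_le_mul_of_nonneg_left h (by positivity)) Real.pi_pos.le
    _ = Real.pi * (1 / (surfaceMeasure (k + 1)).real Set.univ *
        (surfaceMeasure k).real Set.univ) *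
          Metric.diam (B : Set (EuclideanSpace ℝ (Fin k))) := by ring
    _ ≤ _ := mul_le_mul_of_nonneg_right (pi_mul_surfaceMeasure_ratio_le hk) Metric.diam_nonneg

/-- The width of `B` dominates that of each segment `xy` in `B`; the factors `1/(2√k)` and `√k/2`
multiply to `1/4`. -/
theorem diam_le_meanWidth {k : ℕ} (hk : 1 ≤ k) (B : Finset (EuclideanSpace ℝ (Fin k))) :
    1 / 4 * Metric.diam (B : Set (EuclideanSpace ℝ (Fin k))) ≤
      (Diversity.meanWidth k).δ B := by
  suffices Metric.diam (B : Set (EuclideanSpace ℝ (Fin k))) ≤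
      4 * (Diversity.meanWidth k).δ B by linarith
  have h0 := (Diversity.meanWidth k).nonneg B
  refine Metric.diam_le_of_forall_dist_le (by linarith) fun x hx y hy => ?_
  have hk0 : (0 : ℝ) < √k := Real.sqrt_pos.2 (by exact_mod_cast hk)
  have h : ‖x - y‖ / (2 * √k) * (surfaceMeasure k).real Set.univ ≤
      ∫ u, directionalWidth (convexHull ℝ (B : Set (EuclideanSpace ℝ (Fin k))))
      (u : EuclideanSpace ℝ (Fin k)) ∂surfaceMeasure k := by
    refine (le_integral_abs_inner_sphere hk (x - y)).trans ?_
    refine MeasureTheory.integral_mono (integrable_surfaceMeasure (by fun_prop))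
      (integrable_directionalWidth B) fun u => ?_
    simp only [directionalWidth_convexHull, inner_sub_left]
    exact Metric.dist_le_diam_of_mem
      (B.finite_toSet.image fun a => inner ℝ a (u : EuclideanSpace ℝ (Fin k))).isBounded
      (Set.mem_image_of_mem _ hx) (Set.mem_image_of_mem _ hy)
  have h2 : Real.pi * (1 / (surfaceMeasure (k + 1)).real Set.univ *
      (‖x - y‖ / (2 * √k) * (surfaceMeasure k).real Set.univ)) ≤ (Diversity.meanWidth k).δ B :=
    mul_le_mul_of_nonneg_left (mul_le_mul_of_nonneg_left h (by positivity)) Real.pi_pos.le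
  have h3 := mul_le_mul_of_nonneg_left (le_pi_mul_surfaceMeasure_ratio hk)
    (by positivity : 0 ≤ ‖x - y‖ / (2 * √k))
  have h4 : ‖x - y‖ / (2 * √k) * (√k / 2) = ‖x - y‖ / 4 := by field_simp; norm_num
  rw [dist_eq_norm]
  linarith

/-! ### Assembly of the two distortion bounds. -/

open scoped Classical in
theorem ell1_image_ofLp {X : Type*} {k : ℕ} (φ : X → EuclideanSpace ℝ (Fin k)) (A : Finset X) :
    (Diversity.ell1 k).δ (A.image fun x => (φ x).ofLp) =
      ∑ i, Metric.diam ((fun b : EuclideanSpace ℝ (Fin k) => b i) '' (A.image φ : Finset _)) := by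
  simp only [Diversity.ell1, Finset.coe_image, Set.image_image]

theorem mainTheorem7 :
    ∃ C : ℝ, 0 < C ∧
      ∀ (X : Type*) [PseudoMetricSpace X] [Fintype X] (n : ℕ), Fintype.card X = n → 2 ≤ n →
        (∃ (k : ℕ) (φ : X → Fin k → ℝ) (c : ℝ),
          1 ≤ k ∧ (k : ℝ) ≤ C * Real.log n ∧ c ≤ C * Real.log n ^ 2 ∧
          Diversity.HasDistortion (Diversity.diameter X) (Diversity.ell1 k) φ c) ∧
        (∃ (k : ℕ) (φ : X → EuclideanSpace ℝ (Fin k)) (c : ℝ),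
          1 ≤ k ∧ (k : ℝ) ≤ C * Real.log n ∧ c ≤ C * Real.log n ^ (3 / 2 : ℝ) ∧
          Diversity.HasDistortion (Diversity.diameter X) (Diversity.meanWidth k) φ c) := by
  -- The mean-width bound dictates the constant: `24192 = 4 * (3 * 7 * 288)`. The `ℓ₁` bound needs
  -- only `46 * 288`.
  refine ⟨24192, by norm_num, fun X _ _ n hX hn => ?_⟩
  classical
  obtain ⟨k, φ, hk1, hk, hφ⟩ := exists_euclidean_embedding X hX hn
  have hlog2 := Real.log_two_gt_d9
  have hlog : Real.log 2 ≤ Real.log n := Real.log_le_log (by norm_num) (by exact_mod_cast hn)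
  have hl : 1 / 2 ≤ Real.log n := by linarith
  set l := Real.log n
  have hl0 : 0 ≤ 288 * l := by linarith
  have hlow : ∀ A : Finset X, Metric.diam (A : Set X) ≤
      Metric.diam ((A.image φ : Finset _) : Set (EuclideanSpace ℝ (Fin k))) := fun A => by
    rw [Finset.coe_image]
    exact diam_le_diam_image (fun x y => (hφ x y).1) A
  have hup : ∀ A : Finset X, Metric.diam ((A.image φ : Finset _) : Set (EuclideanSpace ℝ (Fin k))) ≤
      288 * l * Metric.diam (A : Set X) := fun A => by
    rw [Finset.coe_image]
    exact diam_image_le_mul_diam hl0 (fun x y => (hφ x y).2) A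
  refine ⟨⟨k, fun x => (φ x).ofLp, 24192 * l ^ 2, hk1, by linarith, le_rfl, by nlinarith, 1,
    24192 * l ^ 2, one_pos, by positivity, (one_mul _).symm, fun A => ?_⟩,
    k, φ, 24192 * l ^ (3 / 2 : ℝ), hk1, by linarith, le_rfl, ?_⟩
  · have hd : 0 ≤ Metric.diam (A : Set X) := Metric.diam_nonneg
    rw [div_one, one_mul]
    simp only [Diversity.diameter]
    refine ⟨(hlow A).trans ((diam_le_sum_diam_coord _).trans_eq ?_), ?_⟩
    · rw [← ell1_image_ofLp]; congr!
    · calc _ = _ := by rw [← ell1_image_ofLp φ A]; congr!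
        _ ≤ _ := sum_diam_coord_le (A.image φ)
        _ ≤ 46 * l * (288 * l * Metric.diam (A : Set X)) :=
            mul_le_mul hk (hup A) Metric.diam_nonneg (by linarith)
        _ ≤ 24192 * l ^ 2 * Metric.diam (A : Set X) := by
            nlinarith [mul_nonneg (sq_nonneg l) hd]
  · have hpow : l ^ (3 / 2 : ℝ) = √l * l := by
      rw [Real.sqrt_eq_rpow, ← Real.rpow_add_one (by linarith)]; norm_num
    have hsl : 1 / 2 ≤ √l := Real.le_sqrt_of_sq_le (by linarith)
    have hsk : √k ≤ 7 * √l := by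
      rw [← Real.sqrt_sq (by norm_num : (0 : ℝ) ≤ 7), ← Real.sqrt_mul (by norm_num)]
      exact Real.sqrt_le_sqrt (by linarith)
    rw [hpow]
    refine ⟨by nlinarith, 4, 6048 * (√l * l), by norm_num, by positivity, by ring, fun A => ?_⟩
    have hd : 0 ≤ Metric.diam (A : Set X) := Metric.diam_nonneg
    simp only [Diversity.diameter]
    constructor
    · refine (mul_le_mul_of_nonneg_left (hlow A) (by norm_num)).trans
        ((diam_le_meanWidth hk1 (A.image φ)).trans_eq ?_)
      congr!
    · calc _ = (Diversity.meanWidth k).δ (A.image φ) := by congr!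
        _ ≤ _ := meanWidth_le hk1 _
        _ ≤ 3 * (7 * √l) * (288 * l * Metric.diam (A : Set X)) :=
            mul_le_mul (by linarith) (hup A) Metric.diam_nonneg (by positivity)
        _ = _ := by ring
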